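/- Let $F$ be a field of characteristic $2$ and let $D$ be a division algebra with centre $F$ and finite dimension over $F$; its degree is $\deg(D)=\sqrt{\dim_F D}$. Assume that $D$ is totally decomposable, that is, $D\simeq Q_1\otimes_F\cdots\otimes_F Q_n$ as $F$-algebras for some $n\geq 0$ and some $F$-quaternion algebras (central simple $F$-algebras of degree $2$) $Q_1,\dots,Q_n$, where for $n=0$ the tensor product is $F$. An $F$-involution on $D$ is an $F$-linear map $\theta:D\to D$ with $\theta(xy)=\theta(y)\theta(x)$ for all $x,y\in D$ and $\theta^2=\mathrm{id}$; put $\mathrm{Alt}(D,\theta)=\{a-\theta(a)\mid a\in D\}$. A hermitian form over $(D,\theta)$ is a pair $(V,h)$ of a finite-dimensional right $D$-vector space $V$ and a bi-additive map $h:V\times V\to D$ with $h(xd_1,yd_2)=\theta(d_1)h(x,y)d_2$ and $h(y,x)=\theta(h(x,y))$ for all $x,y\in V$ and $d_1,d_2\in D$. It is called direct if $h(x,x)\notin\mathrm{Alt}(D,\theta)$ for all $x\in V\setminus\{0\}$. Then $D$ has an $F$-involution, and for every $F$-involution $\theta$ on $D$, $$u^+_d(D):=\sup\{\dim_D V\mid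 (V,h)\text{ is a direct hermitian form over }(D,\theta)\}=\frac{[F:F^2]}{\deg(D)}$$ in $\mathbb{N}\cup\{\infty\}$, where $F^2=\{x^2\mid x\in F\}$ and both sides are $\infty$ if $[F:F^2]=\infty$. In particular, the supremum does not depend on $\theta$. -/

import Mathlib

open scoped TensorProduct ENNReal

universe u v w

noncomputable section

/-- An `F`-linear involution `θ` on an `F`-algebra `A`. -/
structure FInvolution (F : Type u) (A : Type v) [Field F] [Ring A] [Algebra F A]
    extends A →ₗ[F] A where
  map_mul' : ∀ a b : A, toFun (a * b) = toFun b * toFun a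
  invol' : ∀ a : A, toFun (toFun a) = a

instance {F : Type u} {A : Type v} [Field F] [Ring A] [Algebra F A] :
    CoeFun (FInvolution F A) (fun _ => A → A) :=
  ⟨fun θ => θ.toLinearMap⟩

/-- `Alt(A, θ) = {a - θ(a) | a ∈ A}`. -/
def FInvolution.alt {F : Type u} {A : Type v} [Field F] [Ring A] [Algebra F A]
    (θ : FInvolution F A) : Set A :=
  {b | ∃ a : A, b = a - θ a}

/-- A hermitian form `h : V × V → D` over `(D, θ)` on a right `D`-module `V`.
Right `D`-modules are modules over `Dᵐᵒᵖ`: the element `x d` is `MulOpposite.op d • x`. -/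
structure HermForm {F : Type u} {D : Type v} [Field F] [DivisionRing D] [Algebra F D]
    (θ : FInvolution F D) (V : Type w) [AddCommGroup V] [Module Dᵐᵒᵖ V] where
  toFun : V → V → D
  add_left' : ∀ x y z : V, toFun (x + y) z = toFun x z + toFun y z
  add_right' : ∀ x y z : V, toFun x (y + z) = toFun x y + toFun x z
  smul_smul' : ∀ (x y : V) (c d : D),
    toFun (MulOpposite.op c • x) (MulOpposite.op d • y) = θ c * toFun x y * d
  symm' : ∀ x y : V, toFun y x = θ (toFun x y)

/-- `h` is direct if `h(x, x) ∉ Alt(D, θ)` for all nonzero `x`. -/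
def HermForm.IsDirect {F : Type u} {D : Type v} [Field F] [DivisionRing D] [Algebra F D]
    {θ : FInvolution F D} {V : Type w} [AddCommGroup V] [Module Dᵐᵒᵖ V]
    (h : HermForm θ V) : Prop :=
  ∀ x : V, x ≠ 0 → h.toFun x x ∉ θ.alt

/-- The supremum of the dimensions of the direct hermitian forms over `(D, θ)`. Every
finite-dimensional right `D`-vector space is isomorphic to some `Dⁿ`, so letting `V` range over
the universe of `D` loses nothing. -/
def uPlusDirect {F : Type u} {D : Type v} [Field F] [DivisionRing D] [Algebra F D]
    (θ : FInvolution F D) : ℕ∞ :=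
  sSup {n : ℕ∞ | ∃ (V : Type v) (_ : AddCommGroup V) (_ : Module Dᵐᵒᵖ V)
    (_ : Module.Finite Dᵐᵒᵖ V) (h : HermForm θ V),
    h.IsDirect ∧ n = (Module.finrank Dᵐᵒᵖ V : ℕ∞)}

/-- The degree of a central simple `F`-algebra: the square root of its dimension. -/
def csaDegree (F : Type u) (A : Type v) [Field F] [Ring A] [Algebra F A] : ℕ :=
  Nat.sqrt (Module.finrank F A)

/-- The degree `[F : F²]` of `F` over its subfield of squares, in characteristic 2. -/
def degOverSquares (F : Type u) [Field F] [CharP F 2] : ℕ∞ :=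
  Cardinal.toENat (Module.rank (frobenius F 2).fieldRange F)

/-- A quaternion algebra over `F`: a central simple `F`-algebra of degree 2. -/
structure IsQuaternionAlg (F : Type u) (Q : Type v) [Field F] [Ring Q] [Algebra F Q] : Prop where
  isCentral : Algebra.IsCentral F Q
  isSimple : IsSimpleRing Q
  finrank_eq : Module.finrank F Q = 2 ^ 2

/-- `A` is isomorphic to a tensor product `Q₁ ⊗ ⋯ ⊗ Qₙ` over `F` of quaternion algebras; for
`n = 0` the tensor product is `F`. -/
def IsTotallyDecomposable (F : Type u) (A : Type v) [Field F] [Ring A] [Algebra F A] : Prop :=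
  ∃ (n : ℕ) (Q : Fin n → Type w) (_ : ∀ i, Ring (Q i)) (_ : ∀ i, Algebra F (Q i)),
    (∀ i, IsQuaternionAlg F (Q i)) ∧ Nonempty (A ≃ₐ[F] (⨂[F] i, Q i))

end

noncomputable section

/-! By Skolem–Noether two involutions differ by conjugation with an element `u` which, in
characteristic 2, is symmetric; scaling a form by `u⁻¹` preserves directness, so a single convenient
`θ` suffices.

On each quaternion factor take `i² = i + a`, `j² = b`, `ji = ij + j` and the involution fixing `i`
and `j`; tensoring gives an `InvolutionFrame` on `D` with index sets `σ`, `τ` of size `2ⁿ = deg D`.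
A symmetric element is alternating exactly when its coordinates at the fixed vectors of `p` vanish.
In these coordinates `x ↦ θ(x)x` is additive, and its `t`-coordinate is `∑ s, x(s,t)² b s`. The `b
s` are an `F²`-basis of a field `E = F²(b s)`, so `[F:F²] = 2ⁿ[F:E]`.

Lower bound (`diagonalForm_isDirect`): a diagonal form with `E`-independent coefficients is direct,
whence `[F:E] ≤ u`. Upper bound (`finrank_mul_le`): for direct `h`, the class of `h(x,x)` modulo
`Alt` gives an injective Frobenius-semilinear map `V → F^τ`, so `4ⁿ dim_D V ≤ 2ⁿ[F:F²]`, that is,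
`dim_D V ≤ [F:E]`. -/

/-! ### Skolem–Noether for central division algebras -/

/-- Two-sided multiplications by an `F`-independent family are left `D`-independent. -/
theorem eq_zero_of_forall_sum_mul_mul_eq_zero {F : Type u} {D : Type v} [Field F] [DivisionRing D]
    [Algebra F D] [Algebra.IsCentral F D] {ι : Type*} {b : ι → D} (hb : LinearIndependent F b)
    (s : Finset ι) (y : ι → D) (h : ∀ x, ∑ k ∈ s, y k * x * b k = 0) : ∀ k ∈ s, y k = 0 := by
  classical
  induction s using Finset.induction_on generalizing y with
  | empty => simp
  | insert k₀ t hk₀ ih =>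
    by_cases hy : y k₀ = 0
    · have h' := ih y fun x ↦ by simpa [Finset.sum_insert hk₀, hy] using h x
      simpa [hy] using h'
    exfalso
    set z : ι → D := fun k ↦ (y k₀)⁻¹ * y k with hz
    have hz₀ : z k₀ = 1 := inv_mul_cancel₀ hy
    have hzs : ∀ x, x * b k₀ + ∑ k ∈ t, z k * x * b k = 0 := fun x ↦ by
      have := congrArg ((y k₀)⁻¹ * ·) (h x)
      simpa [mul_add, Finset.mul_sum, Finset.sum_insert hk₀, ← mul_assoc, hy, hz] using this
    -- With the coefficient at `k₀` normalised to 1, the relation at `a * x` minus `a` times the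
    -- relation at `x` is a relation over `t` alone. By induction every `z k` commutes with `a`, so
    -- it is central.
    have hcomm : ∀ a, ∀ k ∈ t, z k * a - a * z k = 0 := fun a ↦ by
      refine ih (fun k ↦ z k * a - a * z k) fun x ↦ ?_
      have h₁ := hzs (a * x)
      have h₂ := congrArg (a * ·) (hzs x)
      simp only [mul_add, Finset.mul_sum, mul_zero] at h₂
      have : ∑ k ∈ t, (z k * a - a * z k) * x * b k =
          (a * x * b k₀ + ∑ k ∈ t, z k * (a * x) * b k) -
            (a * (x * b k₀) + ∑ k ∈ t, a * (z k * x * b k)) := by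
        simp only [sub_mul, Finset.sum_sub_distrib, mul_assoc]
        abel
      rw [this, h₁, h₂, sub_zero]
    have hcen : ∀ k ∈ t, ∃ c : F, algebraMap F D c = z k := fun k hk ↦ by
      have : z k ∈ Subalgebra.center F D :=
        Subalgebra.mem_center_iff.2 fun a ↦ (sub_eq_zero.1 (hcomm a k hk)).symm
      rw [Algebra.IsCentral.center_eq_bot] at this
      exact this
    choose! c hc using hcen
    have h1 := hzs 1
    rw [linearIndependent_iff'] at hb
    have := hb (insert k₀ t) (fun k ↦ if k = k₀ then 1 else c k) (by
      rw [Finset.sum_insert hk₀, ← h1]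
      simp only [if_true, one_smul, one_mul, mul_one]
      congr 1
      refine Finset.sum_congr rfl fun k hk ↦ ?_
      rw [if_neg (by rintro rfl; exact hk₀ hk), Algebra.smul_def, hc k hk]) k₀ (by simp)
    simp at this

/-- **Skolem–Noether** for a finite-dimensional central division algebra. -/
theorem exists_mul_eq_mul_of_map_mul {F : Type u} {D : Type v} [Field F] [DivisionRing D]
    [Algebra F D] [FiniteDimensional F D] [Algebra.IsCentral F D] (σ : D →ₗ[F] D)
    (hσ : ∀ x y, σ (x * y) = σ x * σ y) (h1 : σ 1 = 1) :
    ∃ u : D, u ≠ 0 ∧ ∀ x, u * x = σ x * u := by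
  classical
  let b := Module.finBasis F D
  let Ψ : (Fin (Module.finrank F D) → D) →ₗ[F] Module.End F D :=
    { toFun := fun y ↦ ∑ k, LinearMap.mulLeft F (y k) ∘ₗ LinearMap.mulRight F (b k)
      map_add' := fun y z ↦ by
        ext x; simp [Finset.sum_add_distrib, add_mul, LinearMap.sum_apply]
      map_smul' := fun c y ↦ by
        ext x; simp [Finset.smul_sum, LinearMap.sum_apply] }
  have hΨ : ∀ y x, Ψ y x = ∑ k, y k * x * b k := fun y x ↦ by
    simp [Ψ, LinearMap.sum_apply, mul_assoc]
  have hinj : Function.Injective Ψ := by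
    rw [injective_iff_map_eq_zero]
    intro y hy
    ext k
    exact eq_zero_of_forall_sum_mul_mul_eq_zero b.linearIndependent Finset.univ y
      (fun x ↦ by rw [← hΨ, hy]; rfl) k (Finset.mem_univ k)
  -- Both sides have dimension `(dim D)²`, so every `F`-linear endomorphism of `D` is a sum of
  -- two-sided multiplications.
  have hsurj : Function.Surjective Ψ :=
    (LinearMap.injective_iff_surjective_of_finrank_eq_finrank (by
      simp [Module.finrank_pi_fintype, Module.finrank_linearMap])).1 hinj
  obtain ⟨y, hy⟩ := hsurj σ
  -- Compare the coefficients of `b k` in `σ(xz) = σ(x)σ(z)` as functions of `z`. Any nonzero `y k`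
  -- is then the desired `u`.
  have hyx : ∀ x, ∀ k, y k * x = σ x * y k := fun x k ↦ by
    refine sub_eq_zero.1 (eq_zero_of_forall_sum_mul_mul_eq_zero b.linearIndependent Finset.univ
      (fun k ↦ y k * x - σ x * y k) (fun z ↦ ?_) k (Finset.mem_univ k))
    have e := hσ x z
    rw [← hy, hΨ, hΨ y z, hy, Finset.mul_sum] at e
    simp only [sub_mul, Finset.sum_sub_distrib, mul_assoc] at e ⊢
    rw [e, sub_self]
  by_cases h0 : y = 0
  · simp [← hy, h0] at h1
  · obtain ⟨k, hk⟩ := Function.ne_iff.1 h0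
    exact ⟨y k, hk, fun x ↦ hyx x k⟩

namespace FInvolution

variable {F : Type u} {A : Type v} [Field F] [Ring A] [Algebra F A] (θ : FInvolution F A)

theorem map_mul (a b : A) : θ (a * b) = θ b * θ a := θ.map_mul' a b

theorem apply_apply (a : A) : θ (θ a) = a := θ.invol' a

theorem map_one : θ 1 = 1 := by
  have := θ.map_mul (θ 1) 1
  rwa [mul_one, θ.apply_apply, mul_one, eq_comm] at this

end FInvolution

/-! ### Independence of the involution -/

/-- In characteristic two, any two involutions differ by conjugation with a symmetric element. -/
theorem FInvolution.exists_symmetric_conj {F : Type u} {D : Type v} [Field F] [CharP F 2]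
    [DivisionRing D] [Algebra F D] [FiniteDimensional F D] [Algebra.IsCentral F D]
    (θ θ' : FInvolution F D) :
    ∃ u : D, u ≠ 0 ∧ θ u = u ∧ ∀ x, θ' x = u * θ x * u⁻¹ := by
  obtain ⟨u, hu, hux⟩ := exists_mul_eq_mul_of_map_mul (θ'.toLinearMap ∘ₗ θ.toLinearMap)
    (fun x y ↦ by simp [θ.map_mul, θ'.map_mul]) (by simp [θ.map_one, θ'.map_one])
  have hconj : ∀ x, θ' x = u * θ x * u⁻¹ := fun x ↦ by
    rw [hux (θ x), LinearMap.comp_apply, θ.apply_apply, mul_inv_cancel_right₀ hu]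
  have hθu : θ u ≠ 0 := fun h ↦ hu (by rw [← θ.apply_apply u, h, map_zero])
  have hinv : θ u⁻¹ = (θ u)⁻¹ :=
    eq_inv_of_mul_eq_one_left (by rw [← θ.map_mul, mul_inv_cancel₀ hu, θ.map_one])
  -- This expresses `θ'² = id`. The central factor `c` satisfies `c² = 1`, hence `c = 1` in
  -- characteristic 2.
  have hcen : θ u * u⁻¹ ∈ Subalgebra.center F D := by
    refine Subalgebra.mem_center_iff.2 fun x ↦ ?_
    have := θ'.apply_apply x
    rw [hconj (θ' x), hconj x, θ.map_mul, θ.map_mul, θ.apply_apply, hinv] at this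
    have := congrArg (θ u * u⁻¹ * ·) this
    simpa only [mul_assoc, inv_mul_cancel_left₀ hu, mul_inv_cancel_left₀ hθu] using this
  rw [Algebra.IsCentral.center_eq_bot] at hcen
  obtain ⟨c, hc⟩ := hcen
  have hcu : θ u = c • u := by
    rw [Algebra.smul_def, show algebraMap F D c = θ u * u⁻¹ from hc, inv_mul_cancel_right₀ hu]
  have hc2 : (c * c) • u = (1 : F) • u := by
    conv_rhs => rw [one_smul, ← θ.apply_apply u, hcu, map_smul, hcu, smul_smul]
  have hc1 : c = 1 := by
    have := smul_left_injective F hu hc2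
    have h2 : (c + 1) ^ 2 = 0 := by rw [CharTwo.add_sq, sq, this, one_pow, CharTwo.add_self_eq_zero]
    exact CharTwo.add_eq_zero.1 (pow_eq_zero_iff two_ne_zero |>.1 h2)
  exact ⟨u, hu, by rw [hcu, hc1, one_smul], hconj⟩

/-- If `h` is hermitian over `θ'`, then `u⁻¹h` is hermitian over `θ`. Directness survives because
`u(a - θ a) = ua - θ'(ua)`, so `u · Alt(θ) ⊆ Alt(θ')`. -/
theorem uPlusDirect_le_of_conj {F : Type u} {D : Type v} [Field F] [DivisionRing D]
    [Algebra F D] (θ θ' : FInvolution F D) (u : D) (hu : u ≠ 0) (hθu : θ u = u)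
    (hconj : ∀ x, θ' x = u * θ x * u⁻¹) : uPlusDirect θ' ≤ uPlusDirect θ := by
  have hinv : θ u⁻¹ = u⁻¹ :=
    eq_inv_of_mul_eq_one_left (by
      conv_lhs => rw [← hθu]
      rw [hθu]
      nth_rw 2 [← hθu]
      rw [← θ.map_mul, mul_inv_cancel₀ hu, θ.map_one])
  refine sSup_le_sSup ?_
  rintro n ⟨V, _, _, hfin, h, hdir, rfl⟩
  refine ⟨V, inferInstance, inferInstance, hfin,
    { toFun := fun x y ↦ u⁻¹ * h.toFun x y
      add_left' := fun x y z ↦ by rw [h.add_left', mul_add]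
      add_right' := fun x y z ↦ by rw [h.add_right', mul_add]
      smul_smul' := fun x y c d ↦ by
        rw [h.smul_smul', hconj]; simp [mul_assoc, hu]
      symm' := fun x y ↦ by
        rw [θ.map_mul, hinv, h.symm', hconj]; simp [mul_assoc, hu] }, ?_, rfl⟩
  rintro x hx ⟨a, ha⟩
  refine hdir x hx ⟨u * a, ?_⟩
  have : h.toFun x x = u * (u⁻¹ * h.toFun x x) := by simp [hu]
  replace ha : u⁻¹ * h.toFun x x = a - θ a := ha
  rw [this, ha, hconj, θ.map_mul, hθu, mul_sub]
  simp [mul_assoc, hu]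

theorem uPlusDirect_eq {F : Type u} {D : Type v} [Field F] [CharP F 2]
    [DivisionRing D] [Algebra F D] [FiniteDimensional F D] [Algebra.IsCentral F D]
    (θ θ' : FInvolution F D) : uPlusDirect θ = uPlusDirect θ' := by
  obtain ⟨u, hu, hθu, hc⟩ := θ.exists_symmetric_conj θ'
  obtain ⟨u', hu', hθu', hc'⟩ := θ'.exists_symmetric_conj θ
  exact le_antisymm (uPlusDirect_le_of_conj _ _ u' hu' hθu' hc')
    (uPlusDirect_le_of_conj _ _ u hu hθu hc)

/-! ### Quaternion division algebras in characteristic 2 -/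

/-- Every noncentral element of a quaternion division algebra is a root of a monic quadratic
polynomial over the centre. -/
theorem IsQuaternionAlg.exists_mul_self_eq {F : Type u} {Q : Type v} [Field F] [Ring Q]
    [Algebra F Q] [IsDomain Q] (hQ : IsQuaternionAlg F Q) (x : Q)
    (hx : ∀ c : F, x ≠ algebraMap F Q c) : ∃ t n : F, x * x = t • x + algebraMap F Q n := by
  have := hQ.isCentral
  have : FiniteDimensional F Q := FiniteDimensional.of_finrank_pos (by rw [hQ.finrank_eq]; norm_num)
  let K := Algebra.adjoin F {x}
  have hcomm : ∀ a b : K, a * b = b * a :=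
    (Algebra.isMulCommutative_adjoin F (s := {x}) (by simp)).is_comm.comm
  let xK : K := ⟨x, Algebra.self_mem_adjoin_singleton F x⟩
  have hK : IsField K := by
    refine ⟨⟨0, 1, zero_ne_one⟩, hcomm, fun {a} ha ↦ ?_⟩
    have hinj : Function.Injective (LinearMap.mulLeft F a) := fun b c h ↦ mul_left_cancel₀ ha h
    exact (LinearMap.injective_iff_surjective.1 hinj) 1
  let _ := hK.toField
  have hmul : Module.finrank F K * Module.finrank K Q = 4 := by
    rw [Module.finrank_mul_finrank F K Q, hQ.finrank_eq]; norm_num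
  -- The degree of the commutative field `K = F[x]` divides 4; degree 4 would make `K` all of `Q`
  -- and `x` central.
  have hle : Module.finrank F K ≤ 2 := by
    by_contra! hlt
    have h4 : Module.finrank F K = 4 := by
      have hd : Module.finrank F K ∣ 4 := ⟨_, hmul.symm⟩
      have := Nat.le_of_dvd (by norm_num) hd
      interval_cases h : Module.finrank F K <;> omega
    have htop : K = ⊤ := by
      apply Subalgebra.toSubmodule_injective
      rw [Algebra.top_toSubmodule]
      exact Submodule.eq_top_of_finrank_eq (h4.trans (by rw [hQ.finrank_eq]; norm_num))
    have hc : x ∈ Subalgebra.center F Q := by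
      refine Subalgebra.mem_center_iff.2 fun y ↦ ?_
      have hy : y ∈ K := by rw [htop]; trivial
      exact congrArg Subtype.val (hcomm ⟨y, hy⟩ xK)
    rw [Algebra.IsCentral.center_eq_bot] at hc
    obtain ⟨c, hc⟩ := hc
    exact hx c hc.symm
  have hdep : ¬ LinearIndependent F ![1, xK, xK * xK] := fun h ↦ by
    have := h.fintype_card_le_finrank
    simp at this
    omega
  rw [Fintype.linearIndependent_iff] at hdep
  push Not at hdep
  obtain ⟨g, hg, i, hi⟩ := hdep
  have hg' : algebraMap F Q (g 0) + g 1 • x + g 2 • (x * x) = 0 := by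
    have := congrArg Subtype.val hg
    simpa [Fin.sum_univ_three, Algebra.algebraMap_eq_smul_one] using this
  have h2 : g 2 ≠ 0 := fun h2 ↦ by
    rw [h2, zero_smul, add_zero] at hg'
    have h1 : g 1 = 0 := by
      by_contra h1
      refine hx (-(g 1)⁻¹ * g 0) ?_
      have := congrArg ((g 1)⁻¹ • ·) hg'
      simp only [smul_add, smul_smul, inv_mul_cancel₀ h1, one_smul, smul_zero] at this
      rw [add_comm, add_eq_zero_iff_eq_neg] at this
      rw [this, Algebra.algebraMap_eq_smul_one, Algebra.algebraMap_eq_smul_one, smul_smul,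
        neg_mul, neg_smul]
    rw [h1, zero_smul, add_zero, map_eq_zero_iff _ (algebraMap F Q).injective] at hg'
    fin_cases i <;> simp_all
  refine ⟨-(g 2)⁻¹ * g 1, -(g 2)⁻¹ * g 0, ?_⟩
  have := congrArg ((g 2)⁻¹ • ·) hg'
  simp only [smul_add, smul_smul, inv_mul_cancel₀ h2, one_smul, smul_zero,
    Algebra.algebraMap_eq_smul_one] at this
  rw [add_comm, add_eq_zero_iff_eq_neg] at this
  rw [this, Algebra.algebraMap_eq_smul_one]
  simp only [neg_mul, neg_smul]
  abel

/-- A quaternion division algebra in characteristic two contains an Artin–Schreier element. -/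
theorem IsQuaternionAlg.exists_artinSchreier {F : Type u} {Q : Type v} [Field F] [CharP F 2]
    [Ring Q] [Algebra F Q] [IsDomain Q] (hQ : IsQuaternionAlg F Q) :
    ∃ (i y : Q) (a : F), i * i = i + algebraMap F Q a ∧ i * y ≠ y * i := by
  have := hQ.isCentral
  have : CharP Q 2 := charP_of_injective_algebraMap (algebraMap F Q).injective 2
  have hcen : ∀ x : Q, (∀ y, x * y = y * x) → ∃ c : F, algebraMap F Q c = x := fun x hx ↦ by
    have : x ∈ Subalgebra.center F Q := Subalgebra.mem_center_iff.2 fun y ↦ (hx y).symm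
    rw [Algebra.IsCentral.center_eq_bot] at this
    exact this
  -- A noncentral element with nonzero trace coefficient `t` becomes Artin–Schreier after scaling by
  -- `t⁻¹`.
  have key : ∀ (z y : Q) (t n : F), z * y ≠ y * z → t ≠ 0 → z * z = t • z + algebraMap F Q n →
      ∃ (i y : Q) (a : F), i * i = i + algebraMap F Q a ∧ i * y ≠ y * i := by
    intro z y t n hzy ht hz
    refine ⟨t⁻¹ • z, y, t⁻¹ * t⁻¹ * n, ?_, fun h ↦ hzy ?_⟩
    · rw [smul_mul_smul_comm, hz, smul_add, smul_smul, mul_assoc t⁻¹, inv_mul_cancel₀ ht, mul_one,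
        Algebra.algebraMap_eq_smul_one, smul_smul, Algebra.algebraMap_eq_smul_one]
    · rw [smul_mul_assoc, mul_smul_comm] at h
      exact smul_right_injective Q (inv_ne_zero ht) h
  obtain ⟨x, y, hxy⟩ : ∃ x y : Q, x * y ≠ y * x := by
    by_contra! hall
    have : Module.finrank F Q ≤ 1 := by
      refine finrank_le_one 1 fun x ↦ ?_
      obtain ⟨c, hc⟩ := hcen x (hall x)
      exact ⟨c, by rw [← hc, Algebra.algebraMap_eq_smul_one]⟩
    rw [hQ.finrank_eq] at this
    norm_num at this
  have hne : ∀ z w : Q, z * w ≠ w * z → ∀ c : F, z ≠ algebraMap F Q c := by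
    rintro z w hzw c rfl
    exact hzw (Algebra.commutes c w)
  have quad : ∀ z w : Q, z * w ≠ w * z → ∃ t n : F, z * z = t • z + algebraMap F Q n :=
    fun z w h ↦ hQ.exists_mul_self_eq z (hne z w h)
  obtain ⟨t₁, n₁, h₁⟩ := quad x y hxy
  by_cases ht₁ : t₁ ≠ 0
  · exact key x y t₁ n₁ hxy ht₁ h₁
  obtain ⟨t₂, n₂, h₂⟩ := quad y x hxy.symm
  by_cases ht₂ : t₂ ≠ 0
  · exact key y x t₂ n₂ hxy.symm ht₂ h₂
  have hs : (x + y) * y ≠ y * (x + y) := fun h ↦ hxy (by simpa [add_mul, mul_add] using h)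
  obtain ⟨t₃, n₃, h₃⟩ := quad (x + y) y hs
  by_cases ht₃ : t₃ ≠ 0
  · exact key (x + y) y t₃ n₃ hs ht₃ h₃
  push Not at ht₁ ht₂ ht₃
  simp only [ht₁, ht₂, ht₃, zero_smul, zero_add] at h₁ h₂ h₃
  -- Now `x`, `y` and `x + y` all have squares in `F`, so `xy + yx = c` lies in `F`. Then `(xy)² =
  -- c·xy + n₁n₂` with `c ≠ 0`, and `key` applies to `xy`.
  set c := n₃ + n₁ + n₂ with hc
  have hyx : y * x = x * y + algebraMap F Q c := by
    have : (x + y) * (x + y) = x * x + y * y + (x * y + y * x) := by noncomm_ring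
    rw [h₁, h₂, h₃] at this
    have h' : algebraMap F Q c = x * y + y * x := by
      rw [hc, map_add, map_add, this]
      calc _ = (algebraMap F Q n₁ + algebraMap F Q n₁) + (algebraMap F Q n₂ + algebraMap F Q n₂) +
            (x * y + y * x) := by abel
        _ = _ := by simp only [CharTwo.add_self_eq_zero, zero_add]
    rw [h', ← add_assoc, CharTwo.add_self_eq_zero, zero_add]
  have hc0 : c ≠ 0 := fun h ↦ hxy (by rw [hyx, h, map_zero, add_zero])
  have hy0 : y ≠ 0 := by rintro rfl; simp at hxy
  refine key (x * y) y c (n₁ * n₂) ?_ hc0 ?_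
  · intro h
    rw [← mul_assoc] at h
    exact hxy (mul_right_cancel₀ hy0 h)
  · calc x * y * (x * y) = x * (y * x) * y := by simp only [mul_assoc]
      _ = (x * x) * (y * y) + x * algebraMap F Q c * y := by rw [hyx]; noncomm_ring
      _ = _ := by
        rw [h₁, h₂, ← Algebra.commutes c x, map_mul, Algebra.smul_def, mul_assoc, add_comm]

/-- A quaternion division algebra in characteristic two has a standard presentation
`i² = i + a`, `j² = b`, `ji = ij + j`. -/
theorem IsQuaternionAlg.exists_presentation {F : Type u} {Q : Type v} [Field F] [CharP F 2]
    [Ring Q] [Algebra F Q] [IsDomain Q] (hQ : IsQuaternionAlg F Q) :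
    ∃ (i j : Q) (a b : F), i * i = i + algebraMap F Q a ∧ j * j = algebraMap F Q b ∧
      j * i = i * j + j ∧ ∀ α β γ δ : F, α • (1 : Q) + β • i + γ • j + δ • (i * j) = 0 →
        α = 0 ∧ β = 0 ∧ γ = 0 ∧ δ = 0 := by
  have : CharP Q 2 := charP_of_injective_algebraMap (algebraMap F Q).injective 2
  obtain ⟨i, y, a, hi, hiy⟩ := hQ.exists_artinSchreier
  have hiF : ∀ c : F, i ≠ algebraMap F Q c := by
    rintro c rfl
    exact hiy (Algebra.commutes c y)
  set j := i * y + y * i with hj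
  have hj0 : j ≠ 0 := fun h ↦ hiy (CharTwo.add_eq_zero.1 h)
  have hji : j * i = i * j + j := by
    have e1 : j * i = i * y * i + y * i + algebraMap F Q a * y := by
      rw [hj, add_mul, mul_assoc y, hi, mul_add, ← Algebra.commutes a y]; abel
    have e2 : i * j = i * y + algebraMap F Q a * y + i * y * i := by
      rw [hj, mul_add, ← mul_assoc, hi, add_mul, mul_assoc]
    rw [e1, e2, hj]
    calc _ = (i * y + i * y) + (i * y * i + y * i + algebraMap F Q a * y) := by
          rw [CharTwo.add_self_eq_zero, zero_add]
      _ = _ := by abel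
  have hjiF : j * i ≠ i * j := fun h ↦ hj0 (by rw [hji] at h; simpa using h)
  have hjF : ∀ c : F, j ≠ algebraMap F Q c := fun c h ↦ hjiF (by rw [h]; exact Algebra.commutes c i)
  obtain ⟨t, b, hjj⟩ := hQ.exists_mul_self_eq j hjF
  -- `ji = ij + j` makes `j²` commute with `i`; if `t ≠ 0`, then `j` would commute with `i` too.
  have ht : t = 0 := by
    by_contra ht
    have h1 : j * j * i = i * (j * j) := by
      rw [mul_assoc, hji, mul_add, ← mul_assoc, hji, add_mul, add_assoc, CharTwo.add_self_eq_zero,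
        add_zero, mul_assoc]
    rw [hjj, add_mul, mul_add, Algebra.commutes b i, smul_mul_assoc, mul_smul_comm,
      add_left_inj] at h1
    exact hjiF (smul_right_injective Q ht h1)
  have hind : ∀ α β : F, α • (1 : Q) + β • i = 0 → α = 0 ∧ β = 0 := by
    intro α β h
    have hβ : β = 0 := by
      by_contra hβ
      refine hiF (-β⁻¹ * α) ?_
      have := congrArg (β⁻¹ • ·) h
      simp only [smul_add, smul_smul, inv_mul_cancel₀ hβ, one_smul, smul_zero] at this
      rw [add_comm, add_eq_zero_iff_eq_neg] at this
      rw [this, Algebra.algebraMap_eq_smul_one, neg_mul, neg_smul]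
    rw [hβ, zero_smul, add_zero] at h
    exact ⟨(smul_eq_zero.1 h).resolve_right one_ne_zero, hβ⟩
  refine ⟨i, j, a, b, hi, by rw [hjj, ht, zero_smul, zero_add], hji, fun α β γ δ h ↦ ?_⟩
  -- The commutator with `i` kills the part in `F[i]` and leaves `(γ + δi)j`.
  have h1 : (γ • (1 : Q) + δ • i) * j = 0 := by
    have e : (α • (1 : Q) + β • i + γ • j + δ • (i * j)) * i -
        i * (α • (1 : Q) + β • i + γ • j + δ • (i * j)) = (γ • (1 : Q) + δ • i) * j := by
      have : i * j * i = i * (i * j) + i * j := by rw [mul_assoc, hji, mul_add]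
      simp only [add_mul, mul_add, smul_mul_assoc, mul_smul_comm, one_mul, mul_one, this, hji,
        smul_add]
      abel
    rw [← e, h, zero_mul, mul_zero, sub_zero]
  obtain ⟨hγ, hδ⟩ := hind γ δ ((mul_eq_zero.1 h1).resolve_right hj0)
  rw [hγ, hδ, zero_smul, zero_smul, add_zero, add_zero] at h
  obtain ⟨hα, hβ⟩ := hind α β h
  exact ⟨hα, hβ, hγ, hδ⟩

/-! ### Involution frames -/

/-- An involution on `A` together with a basis `p` which it permutes, whose fixed points are
indexed by `τ`, and a basis `e`, indexed by `σ × τ`, such that `θ(e) e` is a multiple of a fixed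
vector of `p`, where the `e (s, t₀)` commute and have the scalar squares `b s`. -/
structure InvolutionFrame (F : Type u) (A : Type v) [Field F] [Ring A] [Algebra F A]
    (σ τ κ : Type) where
  inv : FInvolution F A
  p : Module.Basis κ F A
  perm : κ → κ
  inv_p : ∀ x, inv (p x) = p (perm x)
  fix : τ → κ
  fix_injective : Function.Injective fix
  perm_eq_iff : ∀ x, perm x = x ↔ ∃ t, fix t = x
  e : Module.Basis (σ × τ) F A
  b : σ → F
  inv_e_mul_e : ∀ s t, inv (e (s, t)) * e (s, t) = b s • p (fix t)
  s₀ : σ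
  t₀ : τ
  b_s₀ : b s₀ = 1
  b_mul : ∀ s s', ∃ c u, b s * b s' = c ^ 2 * b u
  e_comm : ∀ s s', e (s, t₀) * e (s', t₀) = e (s', t₀) * e (s, t₀)
  e_mul_self : ∀ s, e (s, t₀) * e (s, t₀) = algebraMap F A (b s)

namespace InvolutionFrame

/-- Transport of a frame along an isomorphism. -/
def map {F : Type u} {A : Type v} {B : Type w} [Field F] [Ring A] [Algebra F A] [Ring B]
    [Algebra F B] {σ τ κ : Type} (f : InvolutionFrame F A σ τ κ) (φ : A ≃ₐ[F] B) :
    InvolutionFrame F B σ τ κ where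
  inv :=
    { toLinearMap := φ.toLinearMap ∘ₗ f.inv.toLinearMap ∘ₗ φ.symm.toLinearMap
      map_mul' := fun a b ↦ by simp [f.inv.map_mul]
      invol' := fun a ↦ by simp [f.inv.apply_apply] }
  p := f.p.map φ.toLinearEquiv
  perm := f.perm
  inv_p x := by simp [f.inv_p]
  fix := f.fix
  fix_injective := f.fix_injective
  perm_eq_iff := f.perm_eq_iff
  e := f.e.map φ.toLinearEquiv
  b := f.b
  inv_e_mul_e s t := by simp [← map_mul, f.inv_e_mul_e]
  s₀ := f.s₀
  t₀ := f.t₀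
  b_s₀ := f.b_s₀
  b_mul := f.b_mul
  e_comm s s' := by simp [← map_mul, f.e_comm s s']
  e_mul_self s := by simp [← map_mul, f.e_mul_self]

/-- The tensor product of frames. -/
def piTensorProduct {F : Type u} [Field F] {n : ℕ} {Q : Fin n → Type w} [∀ i, Ring (Q i)]
    [∀ i, Algebra F (Q i)] {σ τ κ : Type} (f : ∀ i, InvolutionFrame F (Q i) σ τ κ) :
    InvolutionFrame F (⨂[F] i, Q i) (Fin n → σ) (Fin n → τ) (Fin n → κ) where
  inv :=
    { toLinearMap := PiTensorProduct.map fun i ↦ (f i).inv.toLinearMap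
      map_mul' := fun a b ↦ by
        change PiTensorProduct.map _ _ = PiTensorProduct.map _ _ * PiTensorProduct.map _ _
        induction a using PiTensorProduct.induction_on with
        | add x y hx hy => rw [add_mul, map_add, map_add, mul_add, hx, hy]
        | smul_tprod r x =>
          induction b using PiTensorProduct.induction_on with
          | add y z hy hz => rw [mul_add, map_add, map_add, add_mul, hy, hz]
          | smul_tprod s y =>
            simp only [smul_mul_assoc, mul_smul_comm, map_smul, PiTensorProduct.tprod_mul_tprod,
              PiTensorProduct.map_tprod, Pi.mul_apply, FInvolution.map_mul]
            rw [smul_comm]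
            rfl
      invol' := fun a ↦ by
        change PiTensorProduct.map _ (PiTensorProduct.map _ a) = a
        induction a using PiTensorProduct.induction_on with
        | add x y hx hy => rw [map_add, map_add, hx, hy]
        | smul_tprod r x =>
          simp only [map_smul, PiTensorProduct.map_tprod, FInvolution.apply_apply] }
  p := Basis.piTensorProduct fun i ↦ (f i).p
  perm x i := (f i).perm (x i)
  inv_p x := by
    change PiTensorProduct.map _ _ = _
    simp only [Basis.piTensorProduct_apply, PiTensorProduct.map_tprod, (f _).inv_p]
  fix x i := (f i).fix (x i)
  fix_injective x y h := funext fun i ↦ (f i).fix_injective (congrFun h i)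
  perm_eq_iff x := by
    simp only [funext_iff, (f _).perm_eq_iff]
    exact Classical.skolem
  e := (Basis.piTensorProduct fun i ↦ (f i).e).reindex
    (Equiv.arrowProdEquivProdArrow (Fin n) (fun _ ↦ σ) (fun _ ↦ τ))
  b s := ∏ i, (f i).b (s i)
  inv_e_mul_e s t := by
    change PiTensorProduct.map _ _ * _ = _
    simp only [Module.Basis.reindex_apply, Basis.piTensorProduct_apply,
      PiTensorProduct.map_tprod, PiTensorProduct.tprod_mul_tprod]
    rw [← MultilinearMap.map_smul_univ]
    congr 1
    exact funext fun i ↦ (f i).inv_e_mul_e (s i) (t i)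
  s₀ i := (f i).s₀
  t₀ i := (f i).t₀
  b_s₀ := by simp [(f _).b_s₀]
  b_mul s s' := by
    choose c u h using fun i ↦ (f i).b_mul (s i) (s' i)
    exact ⟨∏ i, c i, u, by simp only [← Finset.prod_mul_distrib, ← Finset.prod_pow, h]⟩
  e_comm s s' := by
    simp only [Module.Basis.reindex_apply, Basis.piTensorProduct_apply,
      PiTensorProduct.tprod_mul_tprod]
    congr 1
    exact funext fun i ↦ (f i).e_comm (s i) (s' i)
  e_mul_self s := by
    simp only [Module.Basis.reindex_apply, Basis.piTensorProduct_apply,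
      PiTensorProduct.tprod_mul_tprod]
    rw [Algebra.algebraMap_eq_smul_one, PiTensorProduct.one_def, ← MultilinearMap.map_smul_univ]
    congr 1
    exact funext fun i ↦ ((f i).e_mul_self (s i)).trans (Algebra.algebraMap_eq_smul_one _)

end InvolutionFrame

/-- A quaternion division algebra in characteristic two has a frame. -/
theorem IsQuaternionAlg.nonempty_involutionFrame {F : Type u} {Q : Type v} [Field F] [CharP F 2]
    [Ring Q] [Algebra F Q] [IsDomain Q] (hQ : IsQuaternionAlg F Q) :
    Nonempty (InvolutionFrame F Q Bool Bool (Bool × Bool)) := by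
  have : CharP Q 2 := charP_of_injective_algebraMap (algebraMap F Q).injective 2
  obtain ⟨i, j, a, b, hi, hj, hji, hind⟩ := hQ.exists_presentation
  have hcard : Fintype.card (Bool × Bool) = Module.finrank F Q := by
    rw [hQ.finrank_eq]; rfl
  -- `e'` is `1, i, j, ji` and `p'` is `1, i², ij, ji`. Using `i²` in place of `i` makes `θ(e)e` a
  -- multiple of `1` or `i²`: it equals `1`, `i²`, `b`, `b i²` respectively. The involution swaps
  -- `ij` and `ji`.
  let e' : Bool × Bool → Q := fun x ↦ (if x.1 then j else 1) * (if x.2 then i else 1)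
  let p' : Bool × Bool → Q := fun x ↦
    if x.1 then (if x.2 then j * i else i * j) else (if x.2 then i * i else 1)
  have he' : LinearIndependent F e' := by
    rw [Fintype.linearIndependent_iff]
    intro g hg
    simp only [Fintype.sum_prod_type, Fintype.sum_bool, e', if_true, Bool.false_eq_true, if_false,
      mul_one, one_mul, hji] at hg
    obtain ⟨h1, h2, h3, h4⟩ := hind (g (false, false)) (g (false, true))
      (g (true, false) + g (true, true)) (g (true, true)) (by
        rw [← hg]; simp only [smul_add, add_smul]; abel)
    rw [h4, add_zero] at h3
    rintro ⟨_ | _, _ | _⟩ <;> assumption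
  have hp' : LinearIndependent F p' := by
    rw [Fintype.linearIndependent_iff]
    intro g hg
    simp only [Fintype.sum_prod_type, Fintype.sum_bool, p', if_true, Bool.false_eq_true, if_false,
      hji, hi, Algebra.algebraMap_eq_smul_one] at hg
    obtain ⟨h1, h2, h3, h4⟩ := hind (g (false, false) + g (false, true) * a) (g (false, true))
      (g (true, true)) (g (true, true) + g (true, false)) (by
        rw [← hg]; simp only [smul_add, add_smul, mul_smul]; abel)
    rw [h2, zero_mul, add_zero] at h1
    rw [h3, zero_add] at h4
    rintro ⟨_ | _, _ | _⟩ <;> assumption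
  let e := basisOfLinearIndependentOfCardEqFinrank he' hcard
  let p := basisOfLinearIndependentOfCardEqFinrank hp' hcard
  have he : ∀ x, e x = e' x := fun x ↦ by simp [e]
  have hp : ∀ x, p x = p' x := fun x ↦ by simp [p]
  let T : Q →ₗ[F] Q := e.constr F fun x ↦ (if x.2 then i else 1) * (if x.1 then j else 1)
  have hT : ∀ x, T (e' x) = (if x.2 then i else 1) * (if x.1 then j else 1) := fun x ↦ by
    rw [← he, Module.Basis.constr_basis]
  have T1 : T 1 = 1 := by simpa [e'] using hT (false, false)
  have Ti : T i = i := by simpa [e'] using hT (false, true)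
  have Tj : T j = j := by simpa [e'] using hT (true, false)
  have Tji : T (j * i) = i * j := by simpa [e'] using hT (true, true)
  have Tij : T (i * j) = j * i := by
    have h : i * j = j * i + j := by rw [hji, add_assoc, CharTwo.add_self_eq_zero, add_zero]
    rw [h, map_add, Tji, Tj, hji]
  have Ta : ∀ c : F, T (algebraMap F Q c) = algebraMap F Q c := fun c ↦ by
    rw [Algebra.algebraMap_eq_smul_one, map_smul, T1]
  have ext4 : ∀ f g : Q →ₗ[F] Q, f 1 = g 1 → f i = g i → f j = g j → f (j * i) = g (j * i) →
      f = g := by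
    intro f g h1 h2 h3 h4
    refine e.ext ?_
    rintro ⟨_ | _, _ | _⟩ <;> simpa [he, e']
  have Tmi : ∀ y, T (i * y) = T y * i := by
    have := ext4 (T ∘ₗ LinearMap.mulLeft F i) (LinearMap.mulRight F i ∘ₗ T)
      (by simp [T1, Ti])
      (by simp [Ti, hi, Ta])
      (by simp [Tij, Tj])
      (by
        simp only [LinearMap.comp_apply, LinearMap.mulLeft_apply, LinearMap.mulRight_apply, Tji]
        have e1 : i * (j * i) = algebraMap F Q a * j := by
          rw [hji, mul_add, ← mul_assoc, hi, add_mul, add_right_comm, CharTwo.add_self_eq_zero,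
            zero_add]
        have e2 : i * j * i = algebraMap F Q a * j := by rw [mul_assoc, e1]
        rw [e1, e2, ← Algebra.smul_def, map_smul, Tj])
    exact fun y ↦ congrArg (· y) this
  have Tmj : ∀ y, T (j * y) = T y * j := by
    have := ext4 (T ∘ₗ LinearMap.mulLeft F j) (LinearMap.mulRight F j ∘ₗ T)
      (by simp [T1, Tj])
      (by simp [Ti, Tji])
      (by simp [hj, Ta, Tj])
      (by
        simp only [LinearMap.comp_apply, LinearMap.mulLeft_apply, LinearMap.mulRight_apply, Tji]
        rw [← mul_assoc, hj, mul_assoc, hj, ← Algebra.commutes b i, ← Algebra.smul_def, map_smul,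
          Ti])
    exact fun y ↦ congrArg (· y) this
  -- Anti-multiplicativity for left factors `i` and `j` gives it for every basis vector `1, i, j,
  -- ji`.
  have Tm : ∀ x y, T (x * y) = T y * T x := by
    intro x y
    have := ext4 (T ∘ₗ LinearMap.mulRight F y) (LinearMap.mulLeft F (T y) ∘ₗ T)
      (by simp [T1])
      (by simp [Ti, Tmi])
      (by simp [Tj, Tmj])
      (by simp [mul_assoc, Tmj, Tmi, Ti])
    exact congrArg (· x) this
  have TT : ∀ x, T (T x) = x := by
    have := ext4 (T ∘ₗ T) LinearMap.id (by simp [T1]) (by simp [Ti]) (by simp [Tj])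
      (by simp [Tij, Tji])
    exact fun x ↦ congrArg (· x) this
  refine ⟨{
    inv := { toLinearMap := T, map_mul' := Tm, invol' := TT }
    p := p
    perm := fun x ↦ (x.1, xor x.1 x.2)
    inv_p := ?_
    fix := fun t ↦ (false, t)
    fix_injective := fun s t h ↦ congrArg Prod.snd h
    perm_eq_iff := by decide
    e := e
    b := fun s ↦ if s then b else 1
    inv_e_mul_e := ?_
    s₀ := false
    t₀ := false
    b_s₀ := rfl
    b_mul := ?_
    e_comm := ?_
    e_mul_self := ?_ }⟩
  · change ∀ x, T (p x) = _
    rintro ⟨_ | _, _ | _⟩ <;> simp [hp, p', T1, Tij, Tji, Tm, Ti]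
  · change ∀ s t, T (e (s, t)) * _ = _
    rintro (_ | _) (_ | _)
    · simp [he, hp, e', p', T1]
    · simp [he, hp, e', p', Ti]
    · simp [he, hp, e', p', Tj, hj, Algebra.algebraMap_eq_smul_one]
    · simp only [he, hp, e', p', if_true, Tji, Bool.false_eq_true, if_false]
      rw [mul_assoc, ← mul_assoc j, hj, ← mul_assoc, ← Algebra.commutes, mul_assoc,
        Algebra.smul_def]
  · rintro (_ | _) (_ | _)
    · exact ⟨1, false, by simp⟩
    · exact ⟨1, true, by simp⟩
    · exact ⟨1, true, by simp⟩
    · exact ⟨b, false, by simp [sq]⟩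
  · rintro (_ | _) (_ | _) <;> simp [he, e']
  · rintro (_ | _) <;> simp [he, e', hj]

/-- A totally decomposable division algebra in characteristic two has a frame. -/
theorem IsTotallyDecomposable.exists_involutionFrame {F : Type u} {D : Type v} [Field F]
    [CharP F 2] [DivisionRing D] [Algebra F D] (hD : IsTotallyDecomposable.{u, v, w} F D) :
    ∃ n : ℕ, Nonempty
      (InvolutionFrame F D (Fin n → Bool) (Fin n → Bool) (Fin n → Bool × Bool)) := by
  obtain ⟨n, Q, _, _, hQ, ⟨φ⟩⟩ := hD
  -- Each factor is simple, so its map into the division ring `D` is injective.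
  have hdom : ∀ k, IsDomain (Q k) := fun k ↦ by
    have := (hQ k).isSimple
    let ψ : Q k →ₐ[F] D := φ.symm.toAlgHom.comp (PiTensorProduct.singleAlgHom k)
    have hψ : Function.Injective ψ := RingHom.injective ψ.toRingHom
    exact hψ.isDomain ψ
  let f := fun k ↦ (hQ k).nonempty_involutionFrame.some
  exact ⟨n, ⟨(InvolutionFrame.piTensorProduct f).map φ.symm⟩⟩

/-! ### Alternating elements and the form `θ(x)x` in coordinates -/

namespace InvolutionFrame

variable {F : Type u} {A : Type v} [Field F] [Ring A] [Algebra F A]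
  {σ τ κ : Type} (f : InvolutionFrame F A σ τ κ)

theorem perm_perm (x : κ) : f.perm (f.perm x) = x := by
  refine f.p.injective ?_
  rw [← f.inv_p, ← f.inv_p, f.inv.apply_apply]

theorem repr_inv (a : A) (k : κ) : f.p.repr (f.inv a) k = f.p.repr a (f.perm k) := by
  classical
  have : f.p.coord k ∘ₗ f.inv.toLinearMap = f.p.coord (f.perm k) := by
    refine f.p.ext fun x ↦ ?_
    simp only [LinearMap.comp_apply, f.inv_p, Module.Basis.coord_apply, Module.Basis.repr_self,
      Finsupp.single_apply]
    congr 1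
    rw [eq_iff_iff]
    exact ⟨fun h ↦ by rw [← h, f.perm_perm], fun h ↦ by rw [h, f.perm_perm]⟩
  exact congrArg (· a) this

theorem perm_fix (t : τ) : f.perm (f.fix t) = f.fix t := (f.perm_eq_iff _).2 ⟨t, rfl⟩

theorem repr_fix_eq_zero_of_mem_alt {a : A} (ha : a ∈ f.inv.alt) (t : τ) :
    f.p.repr a (f.fix t) = 0 := by
  obtain ⟨c, rfl⟩ := ha
  rw [map_sub, Finsupp.sub_apply, f.repr_inv, f.perm_fix, sub_self]

variable [CharP F 2]

theorem repr_fix_add_inv (a : A) (t : τ) : f.p.repr (a + f.inv a) (f.fix t) = 0 := by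
  rw [map_add, Finsupp.add_apply, f.repr_inv, f.perm_fix, CharTwo.add_self_eq_zero]

/-- A symmetric element with vanishing coordinates at the fixed points is alternating. -/
theorem mem_alt_of_repr_fix_eq_zero [Finite κ] {a : A} (ha : f.inv a = a)
    (h : ∀ t, f.p.repr a (f.fix t) = 0) : a ∈ f.inv.alt := by
  classical
  have := Fintype.ofFinite κ
  -- An auxiliary order selects one index from each 2-cycle of `perm`; the element `c` carries the
  -- coordinates of `a` there.
  let _ : LinearOrder κ := IsWellOrder.linearOrder (WellOrderingRel (α := κ))
  let c := f.p.equivFun.symm fun x ↦ if x < f.perm x then f.p.repr a x else 0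
  have hc : ∀ x, f.p.repr c x = if x < f.perm x then f.p.repr a x else 0 := fun x ↦ by
    rw [← f.p.equivFun_apply, LinearEquiv.apply_symm_apply]
  refine ⟨c, f.p.repr.injective (Finsupp.ext fun x ↦ ?_)⟩
  rw [map_sub, Finsupp.sub_apply, f.repr_inv, hc, hc, f.perm_perm, ← f.repr_inv a x, ha]
  rcases lt_trichotomy x (f.perm x) with hx | hx | hx
  · rw [if_pos hx, if_neg hx.not_gt, sub_zero]
  · obtain ⟨t, rfl⟩ := (f.perm_eq_iff x).1 hx.symm
    simp [h t]
  · rw [if_neg hx.not_gt, if_pos hx, CharTwo.sub_eq_add, zero_add]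

/-- The coordinates of `θ(x) x` at the fixed points. -/
def normCoord (t : τ) : A →+ F where
  toFun x := f.p.repr (f.inv x * x) (f.fix t)
  map_zero' := by simp
  map_add' x y := by
    -- The cross terms have the form `c + θ(c)` with `c = θ(x)y`, so they vanish at fixed points.
    have h := f.repr_fix_add_inv (f.inv x * y) t
    rw [f.inv.map_mul, f.inv.apply_apply] at h
    have e : f.inv (x + y) * (x + y) =
        f.inv x * x + f.inv y * y + (f.inv x * y + f.inv y * x) := by
      rw [map_add]; noncomm_ring
    rw [e, map_add, Finsupp.add_apply, h, add_zero, map_add, Finsupp.add_apply]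

theorem normCoord_apply (t : τ) (x : A) :
    f.normCoord t x = f.p.repr (f.inv x * x) (f.fix t) := rfl

theorem normCoord_smul (t : τ) (c : F) (x : A) :
    f.normCoord t (c • x) = c ^ 2 * f.normCoord t x := by
  simp only [normCoord_apply, map_smul, smul_mul_smul_comm, Finsupp.smul_apply, smul_eq_mul, sq]

theorem normCoord_eq_sum [Fintype σ] [Fintype τ] (t : τ) (x : A) :
    f.normCoord t x = ∑ s, f.e.repr x (s, t) ^ 2 * f.b s := by
  classical
  have hb : ∀ s t', f.normCoord t (f.e (s, t')) = if t' = t then f.b s else 0 := fun s t' ↦ by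
    rw [normCoord_apply, f.inv_e_mul_e, map_smul, Module.Basis.repr_self, Finsupp.smul_apply,
      Finsupp.single_apply]
    simp [f.fix_injective.eq_iff]
  conv_lhs => rw [← f.e.sum_repr x]
  simp only [map_sum, normCoord_smul, Fintype.sum_prod_type, hb, mul_ite, mul_zero,
    Finset.sum_ite_eq', Finset.mem_univ, if_true]

end InvolutionFrame

/-- Squaring is additive on pairwise commuting elements in characteristic two. -/
theorem CharTwo.sum_mul_sum_self_of_commute {R ι : Type*} [Ring R] [CharP R 2] (s : Finset ι)
    (x : ι → R) (h : ∀ i j, x i * x j = x j * x i) :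
    (∑ i ∈ s, x i) * (∑ i ∈ s, x i) = ∑ i ∈ s, x i * x i := by
  classical
  induction s using Finset.induction_on with
  | empty => simp
  | insert k s hk ih =>
    have hc : x k * ∑ i ∈ s, x i = (∑ i ∈ s, x i) * x k := by
      simp only [Finset.mul_sum, Finset.sum_mul, h k]
    rw [Finset.sum_insert hk, Finset.sum_insert hk, add_mul, mul_add, mul_add, ih, hc,
      add_assoc, ← add_assoc ((∑ i ∈ s, x i) * x k), CharTwo.add_self_eq_zero, zero_add]

/-! ### The field `E` and the two bounds -/

namespace InvolutionFrame

variable {F : Type u} {D : Type v} [Field F] [CharP F 2] [DivisionRing D] [Algebra F D]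
  {σ τ κ : Type} (f : InvolutionFrame F D σ τ κ)

/-- A relation `∑ c_s² b_s = 0` says that `∑ c_s e(s,t₀)` has square zero, since the `e(s,t₀)`
commute. In a division ring the sum itself vanishes, and the `e(s,t₀)` are `F`-independent. -/
theorem linearIndependent_b [Fintype σ] : LinearIndependent (frobenius F 2).fieldRange f.b := by
  have : CharP D 2 := charP_of_injective_algebraMap (algebraMap F D).injective 2
  have hind : LinearIndependent F fun s ↦ f.e (s, f.t₀) :=
    f.e.linearIndependent.comp _ fun s s' h ↦ congrArg Prod.fst h
  rw [Fintype.linearIndependent_iff] at hind ⊢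
  intro g hg
  choose c hc using fun s ↦ (g s).2
  have hc' : ∀ s, (g s : F) = c s * c s := fun s ↦ by rw [← hc s, frobenius_def, sq]
  have hz := hind c (by
    rw [← mul_self_eq_zero, CharTwo.sum_mul_sum_self_of_commute]
    · have := congrArg (algebraMap F D) hg
      simp only [map_sum, map_zero, Subfield.smul_def, smul_eq_mul, hc'] at this
      rw [← this]
      refine Finset.sum_congr rfl fun s _ ↦ ?_
      rw [smul_mul_smul_comm, f.e_mul_self, map_mul _ (c s * c s), Algebra.smul_def]
    · intro s s'
      rw [smul_mul_smul_comm, smul_mul_smul_comm, f.e_comm, mul_comm (c s)])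
  intro s
  ext
  rw [hc' s, hz s, mul_zero, ZeroMemClass.coe_zero]

/-- The subfield `F²(b s | s ∈ σ)` of `F`. -/
def squareField : IntermediateField (frobenius F 2).fieldRange F :=
  Subalgebra.toIntermediateField
    (Submodule.toSubalgebra (Submodule.span (frobenius F 2).fieldRange (Set.range f.b))
      (Submodule.subset_span ⟨f.s₀, f.b_s₀⟩)
      (fun x y hx hy ↦ by
        induction hx, hy using Submodule.span_induction₂ with
        | mem_mem x y hx hy =>
          obtain ⟨s, rfl⟩ := hx
          obtain ⟨s', rfl⟩ := hy
          obtain ⟨c, u, h⟩ := f.b_mul s s'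
          rw [h]
          exact Submodule.smul_mem _ (⟨c ^ 2, c, rfl⟩ : (frobenius F 2).fieldRange)
            (Submodule.subset_span ⟨u, rfl⟩)
        | zero_left y hy => rw [zero_mul]; exact zero_mem _
        | zero_right x hx => rw [mul_zero]; exact zero_mem _
        | add_left x y z _ _ _ h₁ h₂ => rw [add_mul]; exact add_mem h₁ h₂
        | add_right x y z _ _ _ h₁ h₂ => rw [mul_add]; exact add_mem h₁ h₂
        | smul_left r x y _ _ h => rw [smul_mul_assoc]; exact Submodule.smul_mem _ r h
        | smul_right r x y _ _ h => rw [mul_smul_comm]; exact Submodule.smul_mem _ r h))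
    -- Inverses are automatic: `x⁻¹ = (x⁻¹)² x` is an `F²`-multiple of `x`.
    (fun x hx ↦ by
      by_cases h0 : x = 0
      · simp [h0]
      have hmem : x⁻¹ ^ 2 ∈ (frobenius F 2).fieldRange := ⟨x⁻¹, rfl⟩
      have : (⟨_, hmem⟩ : (frobenius F 2).fieldRange) • x = x⁻¹ := by
        change x⁻¹ ^ 2 * x = x⁻¹
        rw [sq, mul_assoc, inv_mul_cancel₀ h0, mul_one]
      exact this ▸ Submodule.smul_mem _ _ hx)

theorem mem_squareField {x : F} :
    x ∈ f.squareField ↔ x ∈ Submodule.span (frobenius F 2).fieldRange (Set.range f.b) := Iff.rfl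

theorem rank_squareField [Fintype σ] :
    Cardinal.toENat (Module.rank (frobenius F 2).fieldRange f.squareField) = Fintype.card σ := by
  have h := rank_span f.linearIndependent_b
  have h' : Module.rank (frobenius F 2).fieldRange f.squareField =
    Module.rank (frobenius F 2).fieldRange
      (Submodule.span (frobenius F 2).fieldRange (Set.range f.b)) := rfl
  rw [h', h, ← Cardinal.toENat_lift.{_, 0}, ← Cardinal.lift_id'.{0, u} (Cardinal.mk _),
    Cardinal.mk_range_eq_of_injective f.linearIndependent_b.injective]
  simp

theorem degOverSquares_eq [Fintype σ] :
    degOverSquares F = Fintype.card σ * Cardinal.toENat (Module.rank f.squareField F) := by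
  rw [degOverSquares, ← rank_mul_rank (frobenius F 2).fieldRange f.squareField F, map_mul,
    f.rank_squareField]

/-- The diagonal hermitian form with coefficients in `F`. -/
def diagonalForm (θ : FInvolution F D) {k : ℕ} (a : Fin k → F) : HermForm θ (Fin k → D) where
  toFun x y := ∑ i, a i • (θ (x i) * y i)
  add_left' x y z := by
    simp only [Pi.add_apply, map_add, add_mul, smul_add, Finset.sum_add_distrib]
  add_right' x y z := by
    simp only [Pi.add_apply, mul_add, smul_add, Finset.sum_add_distrib]
  smul_smul' x y c d := by
    simp only [Pi.smul_apply, MulOpposite.smul_eq_mul_unop, MulOpposite.unop_op, θ.map_mul,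
      Finset.mul_sum, Finset.sum_mul, mul_smul_comm, smul_mul_assoc, mul_assoc]
  symm' x y := by
    simp only [map_sum, map_smul, θ.map_mul, θ.apply_apply]

/-- If the value at `x` is alternating, then `∑ i, a i · N_t(x i) = 0` for each `t`, where `N_t` is
`normCoord` and takes values in `E`. Independence of `a` over `E`, then of `b` over `F²`, kills all
coordinates of `x`. -/
theorem diagonalForm_isDirect [Fintype σ] [Fintype τ] {k : ℕ} {a : Fin k → F}
    (ha : LinearIndependent f.squareField a) : (diagonalForm f.inv a).IsDirect := by
  intro x hx hmem
  refine hx (funext fun i ↦ f.e.repr.map_eq_zero_iff.1 (Finsupp.ext fun ⟨s, t⟩ ↦ ?_))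
  have h0 := f.repr_fix_eq_zero_of_mem_alt hmem t
  have h1 : ∑ i, f.normCoord t (x i) * a i = 0 := by
    rw [← h0]
    simp only [diagonalForm, map_sum, map_smul, Finsupp.finsetSum_apply, Finsupp.smul_apply,
      smul_eq_mul, normCoord_apply, mul_comm]
  have hsq : ∀ i s, f.e.repr (x i) (s, t) ^ 2 ∈ (frobenius F 2).fieldRange :=
    fun i s ↦ ⟨_, rfl⟩
  have hN : ∀ i, f.normCoord t (x i) =
      ∑ s, (⟨_, hsq i s⟩ : (frobenius F 2).fieldRange) • f.b s := fun i ↦ by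
    rw [normCoord_eq_sum]; rfl
  have hmemE : ∀ i, f.normCoord t (x i) ∈ f.squareField := fun i ↦ by
    rw [hN, mem_squareField]
    exact sum_mem fun s _ ↦ Submodule.smul_mem _ _ (Submodule.subset_span ⟨s, rfl⟩)
  have h2 : f.normCoord t (x i) = 0 := congrArg Subtype.val
    (Fintype.linearIndependent_iff.1 ha (fun i ↦ ⟨_, hmemE i⟩) h1 i)
  rw [hN] at h2
  have h3 := congrArg Subtype.val (Fintype.linearIndependent_iff.1 f.linearIndependent_b _ h2 s)
  exact pow_eq_zero_iff two_ne_zero |>.1 h3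

theorem le_uPlusDirect [Fintype σ] [Fintype τ] :
    Cardinal.toENat (Module.rank f.squareField F) ≤ uPlusDirect f.inv := by
  refine ENat.forall_natCast_le_iff_le.1 fun k hk ↦ ?_
  rw [Cardinal.natCast_le_toENat, le_rank_iff_exists_linearIndependent_finset] at hk
  obtain ⟨s, rfl, hs⟩ := hk
  let ε : Dᵐᵒᵖ ≃ₗ[Dᵐᵒᵖ] D :=
    { MulOpposite.opAddEquiv.symm with
      map_smul' := fun c x ↦ rfl }
  have := Module.Finite.equiv ε
  refine le_sSup ⟨Fin s.card → D, inferInstance, inferInstance, inferInstance,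
    diagonalForm f.inv fun i ↦ (s.equivFin.symm i : F),
    f.diagonalForm_isDirect (hs.comp _ s.equivFin.symm.injective), ?_⟩
  have e : Module.finrank Dᵐᵒᵖ (Fin s.card → D) = s.card := by
    simp [Module.finrank_pi_fintype, ← ε.finrank_eq]
  rw [e]

/-- Directness makes `x ↦ h(x,x)` modulo `Alt` injective. It is additive because cross terms are
alternating, and semilinear along Frobenius `F → F²`, so `dim_F V` is at most the `F²`-dimension of
`F^τ`. -/
theorem finrank_mul_le [FiniteDimensional F D] [Fintype τ] [Finite κ] {V : Type v}
    [AddCommGroup V] [Module Dᵐᵒᵖ V] [Module.Finite Dᵐᵒᵖ V] (h : HermForm f.inv V)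
    (hdir : h.IsDirect) :
    ((Module.finrank Dᵐᵒᵖ V * Module.finrank F D : ℕ) : ℕ∞) ≤
      Fintype.card τ * degOverSquares F := by
  let B := (Module.finBasis Dᵐᵒᵖ V).equivFun.symm
  let j : (Fin (Module.finrank Dᵐᵒᵖ V) → Dᵐᵒᵖ) →+ (τ → F) :=
    { toFun := fun c t ↦ f.p.repr (h.toFun (B c) (B c)) (f.fix t)
      map_zero' := by
        funext t
        have : h.toFun 0 0 = 0 := by simpa using h.add_left' 0 0 0
        simp [this]
      map_add' := fun x y ↦ by
        funext t
        have hz := f.repr_fix_add_inv (h.toFun (B x) (B y)) t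
        rw [← h.symm'] at hz
        have e : h.toFun (B x + B y) (B x + B y) = h.toFun (B x) (B x) + h.toFun (B y) (B y) +
            (h.toFun (B x) (B y) + h.toFun (B y) (B x)) := by
          rw [h.add_left', h.add_right', h.add_right']; abel
        rw [map_add, e, map_add, Finsupp.add_apply, hz, add_zero, map_add, Finsupp.add_apply]
        rfl }
  have hj := lift_rank_le_of_surjective_injective (frobenius F 2).rangeRestrictField j
    (frobenius F 2).rangeRestrict_surjective
    ((injective_iff_map_eq_zero j).2 fun c hc ↦ by
      by_contra hne
      refine hdir (B c) (by simpa using hne) ?_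
      exact f.mem_alt_of_repr_fix_eq_zero (h.symm' _ _).symm fun t ↦ congrFun hc t)
    (fun r c ↦ by
      funext t
      have hr : r • c = (MulOpposite.op (algebraMap F D r)) • c := by
        funext i
        simp [Algebra.smul_def]
      have hi : f.inv (algebraMap F D r) = algebraMap F D r := by
        rw [Algebra.algebraMap_eq_smul_one, map_smul, f.inv.map_one]
      change f.p.repr (h.toFun (B (r • c)) (B (r • c))) (f.fix t) =
        r ^ 2 * f.p.repr (h.toFun (B c) (B c)) (f.fix t)
      rw [hr, map_smul, h.smul_smul', hi, mul_assoc, ← Algebra.commutes, ← Algebra.smul_def,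
        ← Algebra.smul_def, map_smul, map_smul, Finsupp.smul_apply, Finsupp.smul_apply,
        smul_smul, smul_eq_mul, sq])
  have hj' := OrderHomClass.mono Cardinal.toENat hj
  have := Module.Finite.equiv (MulOpposite.opLinearEquiv F (M := D))
  rw [← Module.finrank_eq_rank F (Fin _ → Dᵐᵒᵖ), rank_pi] at hj'
  simpa [Module.finrank_pi_fintype, ← (MulOpposite.opLinearEquiv F (M := D)).finrank_eq,
    degOverSquares, ← Module.finrank_eq_rank Dᵐᵒᵖ V, ← Module.finrank_eq_rank F D,
    -Module.finrank_eq_rank] using hj'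

theorem uPlusDirect_inv_eq [FiniteDimensional F D] [Fintype σ] [Fintype τ] [Finite κ]
    (hcard : Fintype.card σ = Fintype.card τ) :
    uPlusDirect f.inv = Cardinal.toENat (Module.rank f.squareField F) := by
  have hfin : Module.finrank F D = Fintype.card σ * Fintype.card τ := by
    rw [Module.finrank_eq_card_basis f.e, Fintype.card_prod]
  have hτ : Fintype.card τ ≠ 0 := (Fintype.card_pos_iff.2 ⟨f.t₀⟩).ne'
  refine le_antisymm (sSup_le ?_) f.le_uPlusDirect
  rintro n ⟨V, _, _, _, h, hdir, rfl⟩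
  have := f.finrank_mul_le h hdir
  -- Since `|σ| = |τ|`, the factor `|τ|²` appears on both sides and is cancelled.
  rw [f.degOverSquares_eq, hfin, mul_comm, ← mul_assoc, hcard, Nat.cast_mul,
    ← Nat.cast_mul (Fintype.card τ)] at this
  exact (ENat.mul_le_mul_left_iff (by simpa using hτ) (ENat.natCast_ne_top _)).1 this

end InvolutionFrame

end

theorem mainTheorem4 (F : Type u) (D : Type v) [Field F] [CharP F 2] [DivisionRing D]
    [Algebra F D] [FiniteDimensional F D] [Algebra.IsCentral F D]
    (hD : IsTotallyDecomposable.{u, v, w} F D) :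
    Nonempty (FInvolution F D) ∧
      ∀ θ : FInvolution F D,
        (uPlusDirect θ : ℝ≥0∞) = (degOverSquares F : ℝ≥0∞) / (csaDegree F D : ℝ≥0∞) := by
  obtain ⟨n, ⟨f⟩⟩ := hD.exists_involutionFrame
  refine ⟨⟨f.inv⟩, fun θ ↦ ?_⟩
  have hdeg : csaDegree F D = Fintype.card (Fin n → Bool) := by
    rw [csaDegree, Module.finrank_eq_card_basis f.e, Fintype.card_prod, Nat.sqrt_eq]
  rw [uPlusDirect_eq θ f.inv, f.uPlusDirect_inv_eq rfl, f.degOverSquares_eq, hdeg,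
    ENat.toENNReal_mul, mul_comm, ENat.toENNReal_coe, ENNReal.mul_div_cancel_right]
  · simp
  · exact ENNReal.natCast_ne_top _
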